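/- All graphs are finite and simple. For graphs $F_1, F_2, G$ write $G \to (F_1,F_2)$ if for every colouring of the edges of $G$ with red and blue, $G$ contains a red copy of $F_1$ or a blue copy of $F_2$ (as a not necessarily induced subgraph). The size Ramsey number $\hat r(F_1,F_2)$ is the minimum number of edges of a graph $G$ such that $G \to (F_1,F_2)$. Let $K_{1,n}$ denote the star with $n$ leaves, let $\sqcup$ denote disjoint union, and let $2K_{1,n} = K_{1,n} \sqcup K_{1,n}$. Let $t \ge 1$ and $n \ge 1$ be integers, and let $m_1 \ge m_2 \ge \cdots \ge m_t \ge 2$ be integers. Let $F_1 = 2K_{1,n}$ and $F_2 = \bigsqcup_{i=1}^{t} K_{1,m_i}$. Then $$\hat r(F_1, F_2) = n + m_1 - 1 + \sum_{i=1}^{t} (n + m_i - 1).$$ -/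

import Mathlib

open SimpleGraph

/-- The disjoint union of a family of graphs: each `H i` lives on its own copy of its vertex set,
and there are no edges between different copies. -/
def graphDisjointUnion {ι : Type*} {V : ι → Type*} (H : (i : ι) → SimpleGraph (V i)) :
    SimpleGraph (Σ i, V i) where
  Adj a b := ∃ (i : ι) (x y : V i), (H i).Adj x y ∧ a = ⟨i, x⟩ ∧ b = ⟨i, y⟩
  symm := ⟨fun _ _ ⟨i, x, y, h, ha, hb⟩ => ⟨i, y, x, h.symm, hb, ha⟩⟩
  loopless := ⟨by
    rintro a ⟨i, x, y, h, rfl, hb⟩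
    obtain rfl : x = y := by simpa using hb
    exact h.ne rfl⟩

/-- The star `K_{1,n}`: one root joined to `n` leaves. -/
abbrev star1 (n : ℕ) : SimpleGraph (Fin 1 ⊕ Fin n) :=
  completeBipartiteGraph (Fin 1) (Fin n)

/-- The star forest `K_{1,m_1} ⊔ ⋯ ⊔ K_{1,m_t}`. -/
abbrev starForest {t : ℕ} (m : Fin t → ℕ) : SimpleGraph (Σ i : Fin t, Fin 1 ⊕ Fin (m i)) :=
  graphDisjointUnion fun i => star1 (m i)

/-- `G → (F₁, F₂)`: for every colouring of the edges of `G` with the colours `0` (red) and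
`1` (blue), there is a red copy of `F₁` or a blue copy of `F₂` (as a not necessarily induced
subgraph). -/
def IsRamseyFor {V V₁ V₂ : Type*} (G : SimpleGraph V) (F₁ : SimpleGraph V₁)
    (F₂ : SimpleGraph V₂) : Prop :=
  ∀ C : G.EdgeLabeling (Fin 2),
    F₁.IsContained (C.labelGraph 0) ∨ F₂.IsContained (C.labelGraph 1)

/-- The size Ramsey number: the minimum number of edges of a finite graph `G` with
`G → (F₁, F₂)`. -/
noncomputable def sizeRamseyNumber {V₁ V₂ : Type*} (F₁ : SimpleGraph V₁)
    (F₂ : SimpleGraph V₂) : ℕ :=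
  sInf {e : ℕ | ∃ (V : Type) (_ : Finite V) (G : SimpleGraph V),
    IsRamseyFor G F₁ F₂ ∧ G.edgeSet.ncard = e}

/-! ### Star forests placed in a graph -/

/-! Write `n = a + 1`. The upper bound is witnessed by stars of sizes `a + m i` plus one spare of
size `a + m i₀`, where `m i₀` is the largest: without two red stars at most one of these has more
than `a` red edges, and the spare can replace it (`isRamseyFor_starForest`).

For the lower bound, a colouring has no red `2K_{1,a+1}` once all red degrees are at most `a` after
deleting the edges at one vertex `v` (`IsStarPlacement.not_of_edeg_le`). Take `v` of maximum degree,
colour its edges red, and also colour red `a` maximum matchings peeled off the rest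
(`exists_peeling`). The blue forest forced by the arrow relation is present in every round, so each
matching has at least `t` edges; together with `∑ m i` blue edges and the degree of `v` this
suffices if that degree is at least `a + m i₀`. If instead `m i₀ ≥ 3`, a matching missing the centre
of star `i₀` has at least `t + 1` edges, which makes up for a smaller degree.

What remains is `m i = 2` throughout with maximum degree at most `a + 1`. There the blue edges are a
matching together with all edges at a few vertices it misses (`exists_matching_uncovered_le`). -/

theorem starForest_isContained_iff {V : Type*} {t : ℕ} {m : Fin t → ℕ} {G : SimpleGraph V} :
    (starForest m).IsContained G ↔ ∃ f : (Σ i : Fin t, Fin 1 ⊕ Fin (m i)) → V,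
      Function.Injective f ∧ ∀ i j, G.Adj (f ⟨i, .inl 0⟩) (f ⟨i, .inr j⟩) := by
  constructor
  · rintro ⟨g⟩
    refine ⟨g, g.injective, fun i j => g.toHom.map_adj ?_⟩
    exact ⟨i, .inl 0, .inr j, by simp, rfl, rfl⟩
  · rintro ⟨f, hf, h⟩
    refine ⟨⟨⟨f, ?_⟩, hf⟩⟩
    rintro _ _ ⟨i, x, y, hxy, rfl, rfl⟩
    rcases x with x | x <;> rcases y with y | y
    · simp at hxy
    · rw [Subsingleton.elim x 0]
      exact h i y
    · rw [Subsingleton.elim y 0]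
      exact (h i x).symm
    · simp at hxy

/-- The map `f` places the stars `K_{1,m i}` vertex-disjointly, using only edges from `E`. -/
structure IsStarPlacement {V : Type*} {t : ℕ} (m : Fin t → ℕ) (E : Finset (Sym2 V))
    (f : (Σ i : Fin t, Fin 1 ⊕ Fin (m i)) → V) : Prop where
  inj : Function.Injective f
  mem : ∀ i j, s(f ⟨i, .inl 0⟩, f ⟨i, .inr j⟩) ∈ E

theorem IsStarPlacement.mono {V : Type*} {t : ℕ} {m : Fin t → ℕ} {E E' : Finset (Sym2 V)}
    {f : (Σ i : Fin t, Fin 1 ⊕ Fin (m i)) → V} (h : IsStarPlacement m E f) (hE : E ⊆ E') :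
    IsStarPlacement m E' f :=
  ⟨h.inj, fun i j => hE (h.mem i j)⟩

theorem IsStarPlacement.center_ne_leaf {V : Type*} {t : ℕ} {m : Fin t → ℕ} {E : Finset (Sym2 V)}
    {f : (Σ i : Fin t, Fin 1 ⊕ Fin (m i)) → V} (h : IsStarPlacement m E f) (i i' : Fin t)
    (j : Fin (m i')) : f ⟨i, .inl 0⟩ ≠ f ⟨i', .inr j⟩ := by
  intro hh
  have := h.inj hh
  rw [Sigma.mk.injEq] at this
  obtain ⟨rfl, h2⟩ := this
  simp at h2

theorem IsStarPlacement.center_inj {V : Type*} {t : ℕ} {m : Fin t → ℕ} {E : Finset (Sym2 V)}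
    {f : (Σ i : Fin t, Fin 1 ⊕ Fin (m i)) → V} (h : IsStarPlacement m E f) {i i' : Fin t}
    (hi : f ⟨i, .inl 0⟩ = f ⟨i', .inl 0⟩) : i = i' :=
  congrArg Sigma.fst (h.inj hi)

theorem IsStarPlacement.leaf_inj {V : Type*} {t : ℕ} {m : Fin t → ℕ} {E : Finset (Sym2 V)}
    {f : (Σ i : Fin t, Fin 1 ⊕ Fin (m i)) → V} (h : IsStarPlacement m E f) (i : Fin t) :
    Function.Injective fun j => f ⟨i, .inr j⟩ := by
  intro j j' hj
  have := h.inj hj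
  simpa using this

theorem IsStarPlacement.edge_inj {V : Type*} {t : ℕ} {m : Fin t → ℕ} {E : Finset (Sym2 V)}
    {f : (Σ i : Fin t, Fin 1 ⊕ Fin (m i)) → V} (h : IsStarPlacement m E f) :
    Function.Injective fun p : (Σ i : Fin t, Fin (m i)) =>
      s(f ⟨p.1, .inl 0⟩, f ⟨p.1, .inr p.2⟩) := by
  rintro ⟨i, j⟩ ⟨i', j'⟩ hp
  simp only [Sym2.eq_iff] at hp
  rcases hp with ⟨h1, h2⟩ | ⟨h1, -⟩
  · obtain rfl := h.center_inj h1
    rw [h.leaf_inj i h2]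
  · exact absurd h1 (h.center_ne_leaf _ _ _)

theorem IsStarPlacement.sum_le_card {V : Type*} {t : ℕ} {m : Fin t → ℕ} {E : Finset (Sym2 V)}
    {f : (Σ i : Fin t, Fin 1 ⊕ Fin (m i)) → V} (h : IsStarPlacement m E f) :
    ∑ i, m i ≤ E.card := by
  have := Finset.card_le_card_of_injOn (s := Finset.univ) (t := E) _
    (fun p _ => h.mem p.1 p.2) h.edge_inj.injOn
  simpa using this

/-! ### Degrees in a finite set of edges -/

section edeg

variable {V : Type*} [DecidableEq V]

/-- The number of edges of `E` at the vertex `v`. -/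
def edeg (E : Finset (Sym2 V)) (v : V) : ℕ := (E.filter (v ∈ ·)).card

@[simp]
theorem edeg_empty (v : V) : edeg ∅ v = 0 := by simp [edeg]

theorem edeg_mono {E E' : Finset (Sym2 V)} (h : E ⊆ E') (v : V) : edeg E v ≤ edeg E' v :=
  Finset.card_le_card (Finset.filter_subset_filter _ h)

theorem edeg_pos {E : Finset (Sym2 V)} {v : V} : 0 < edeg E v ↔ ∃ e ∈ E, v ∈ e := by
  simp [edeg, Finset.card_pos, Finset.filter_nonempty_iff]

theorem edeg_insert {E : Finset (Sym2 V)} {e : Sym2 V} (he : e ∉ E) (v : V) :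
    edeg (insert e E) v = edeg E v + if v ∈ e then 1 else 0 := by
  unfold edeg
  rw [Finset.filter_insert]
  split_ifs with h
  · rw [Finset.card_insert_of_notMem (by simp [he])]
  · simp

theorem edeg_erase {E : Finset (Sym2 V)} {e : Sym2 V} (he : e ∈ E) (v : V) :
    edeg (E.erase e) v + (if v ∈ e then 1 else 0) = edeg E v := by
  rw [← edeg_insert (Finset.notMem_erase e E), Finset.insert_erase he]

theorem edeg_union {E E' : Finset (Sym2 V)} (h : Disjoint E E') (v : V) :
    edeg (E ∪ E') v = edeg E v + edeg E' v := by
  unfold edeg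
  rw [Finset.filter_union, Finset.card_union_of_disjoint (Finset.disjoint_filter_filter h)]

theorem edeg_sdiff {E E' : Finset (Sym2 V)} (h : E' ⊆ E) (v : V) :
    edeg (E \ E') v + edeg E' v = edeg E v := by
  rw [← edeg_union Finset.sdiff_disjoint, Finset.sdiff_union_of_subset h]

theorem edeg_le_one_iff {E : Finset (Sym2 V)} {v : V} :
    edeg E v ≤ 1 ↔ ∀ e ∈ E, ∀ e' ∈ E, v ∈ e → v ∈ e' → e = e' := by
  unfold edeg
  rw [Finset.card_le_one]
  simp only [Finset.mem_filter]
  grind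

theorem sum_edeg_le [Fintype V] (E : Finset (Sym2 V)) : ∑ v, edeg E v ≤ 2 * E.card := by
  unfold edeg
  have := Finset.sum_card_bipartiteAbove_eq_sum_card_bipartiteBelow (s := (Finset.univ : Finset V))
    (t := E) (r := fun v e => v ∈ e)
  unfold Finset.bipartiteAbove Finset.bipartiteBelow at this
  rw [this, mul_comm]
  refine Finset.sum_le_card_nsmul _ _ _ fun e _ => ?_
  induction e with
  | h x y =>
    refine (Finset.card_le_card (t := {x, y}) ?_).trans Finset.card_le_two
    intro z
    simp

theorem IsStarPlacement.add_edeg_le {t : ℕ} {m : Fin t → ℕ} {E R : Finset (Sym2 V)}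
    {f : (Σ i : Fin t, Fin 1 ⊕ Fin (m i)) → V} (h : IsStarPlacement m (E \ R) f) (hR : R ⊆ E)
    (i : Fin t) : m i + edeg R (f ⟨i, .inl 0⟩) ≤ edeg E (f ⟨i, .inl 0⟩) := by
  rw [← edeg_sdiff hR]
  refine Nat.add_le_add_right ?_ _
  have := Finset.card_le_card_of_injOn (s := Finset.univ)
    (t := (E \ R).filter (f ⟨i, .inl 0⟩ ∈ ·)) (fun j : Fin (m i) =>
      s(f ⟨i, .inl 0⟩, f ⟨i, .inr j⟩))
    (fun j _ => by simpa using h.mem i j)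
    (fun j _ j' _ hj => by
      have := h.edge_inj (a₁ := ⟨i, j⟩) (a₂ := ⟨i, j'⟩) hj
      simpa using this)
  simpa [edeg] using this

end edeg

/-! ### Maximum matchings and star forests -/

section matching

variable {V : Type*} [DecidableEq V] [Fintype V]

theorem IsStarPlacement.sum_edeg_le {t : ℕ} {m : Fin t → ℕ} {E : Finset (Sym2 V)}
    {f : (Σ i : Fin t, Fin 1 ⊕ Fin (m i)) → V} (h : IsStarPlacement m E f)
    (M : Finset (Sym2 V)) :
    ∑ i, (edeg M (f ⟨i, .inl 0⟩) + ∑ j, edeg M (f ⟨i, .inr j⟩)) ≤ 2 * M.card := by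
  refine le_trans ?_ (_root_.sum_edeg_le M)
  calc _ = ∑ p, edeg M (f p) := by
        rw [Fintype.sum_sigma]
        simp [Fintype.sum_sum_type]
    _ = ∑ v ∈ Finset.univ.map ⟨f, h.inj⟩, edeg M v := by simp
    _ ≤ _ := Finset.sum_le_sum_of_subset (Finset.subset_univ _)

/-- In a maximum matching chosen to use as many edges of the star forest as possible, each star
has a matched centre and a matched leaf, or has all its leaves matched. -/
theorem IsStarPlacement.exists_adapted_matching {t : ℕ} {m : Fin t → ℕ} {E M : Finset (Sym2 V)}
    {f : (Σ i : Fin t, Fin 1 ⊕ Fin (m i)) → V} (h : IsStarPlacement m E f)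
    (hME : M ⊆ E) (hM : ∀ v, edeg M v ≤ 1)
    (hmax : ∀ M' ⊆ E, (∀ v, edeg M' v ≤ 1) → M'.card ≤ M.card) (i₀ : Fin t) :
    ∃ M' : Finset (Sym2 V), M'.card = M.card ∧
      edeg M' (f ⟨i₀, .inl 0⟩) ≤ edeg M (f ⟨i₀, .inl 0⟩) ∧
      ∀ i, (∃ j, s(f ⟨i, .inl 0⟩, f ⟨i, .inr j⟩) ∈ M') ∨ ∀ j, 1 ≤ edeg M' (f ⟨i, .inr j⟩) := by
  set F : Finset (Sym2 V) := Finset.univ.image fun p : (Σ i : Fin t, Fin (m i)) =>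
      s(f ⟨p.1, .inl 0⟩, f ⟨p.1, .inr p.2⟩) with hF
  -- The last constraint keeps the centre of star `i₀` unmatched if `M` misses it.
  obtain ⟨M', hM', hbest⟩ := Finset.exists_max_image
    (E.powerset.filter fun M' => (∀ v, edeg M' v ≤ 1) ∧ M'.card = M.card ∧
      edeg M' (f ⟨i₀, .inl 0⟩) ≤ edeg M (f ⟨i₀, .inl 0⟩)) (fun M' => (M' ∩ F).card)
    ⟨M, by simp [hME, hM]⟩
  simp only [Finset.mem_filter, Finset.mem_powerset] at hM' hbest
  obtain ⟨hE', hm', hc', hd'⟩ := hM'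
  refine ⟨M', hc', hd', fun i => ?_⟩
  by_contra! hcon
  obtain ⟨hown, l, hl⟩ := hcon
  have hl0 : edeg M' (f ⟨i, .inr l⟩) = 0 := by lia
  have hnew := hown l
  -- A free centre would allow a larger matching; otherwise the edge at the centre is swapped for a
  -- forest edge, contradicting the choice of `M'`.
  by_cases hc : edeg M' (f ⟨i, .inl 0⟩) = 0
  · have := hmax (insert s(f ⟨i, .inl 0⟩, f ⟨i, .inr l⟩) M')
      (Finset.insert_subset (h.mem i l) hE') (fun v => by
        rw [edeg_insert hnew]
        split_ifs with hv
        · rcases Sym2.mem_iff.1 hv with rfl | rfl <;> lia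
        · exact hm' v)
    rw [Finset.card_insert_of_notMem hnew] at this
    lia
  · obtain ⟨e, he, hce⟩ := edeg_pos.1 (Nat.pos_of_ne_zero hc)
    have heF : e ∉ F := by
      intro heF
      rw [hF, Finset.mem_image] at heF
      obtain ⟨⟨k, q⟩, -, rfl⟩ := heF
      rcases Sym2.mem_iff.1 hce with h1 | h1
      · obtain rfl := h.center_inj h1
        exact hown q he
      · exact h.center_ne_leaf _ _ _ h1
    have hnew' : s(f ⟨i, .inl 0⟩, f ⟨i, .inr l⟩) ∉ M'.erase e := fun hh =>
      hnew (Finset.mem_of_mem_erase hh)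
    have hdeg : ∀ v, v ≠ f ⟨i, .inr l⟩ →
        edeg (insert s(f ⟨i, .inl 0⟩, f ⟨i, .inr l⟩) (M'.erase e)) v ≤ edeg M' v := by
      intro v hv
      rw [edeg_insert hnew', ← edeg_erase he v]
      refine Nat.add_le_add_left ?_ _
      split_ifs with h1 h2 h2
      · rfl
      · rcases Sym2.mem_iff.1 h1 with rfl | rfl
        · exact absurd hce h2
        · exact absurd rfl hv
      · simp
      · rfl
    have := hbest (insert s(f ⟨i, .inl 0⟩, f ⟨i, .inr l⟩) (M'.erase e))
      ⟨Finset.insert_subset (h.mem i l) ((Finset.erase_subset _ _).trans hE'), fun v => by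
        by_cases hv : v = f ⟨i, .inr l⟩
        · rw [edeg_insert hnew']
          have := edeg_mono (Finset.erase_subset e M') v
          rw [hv] at this ⊢
          split_ifs <;> lia
        · exact (hdeg v hv).trans (hm' v), by
        rw [Finset.card_insert_of_notMem hnew', Finset.card_erase_of_mem he]
        have := Finset.card_pos.2 ⟨e, he⟩
        lia, (hdeg _ (h.center_ne_leaf _ _ _)).trans hd'⟩
    have hsF : s(f ⟨i, .inl 0⟩, f ⟨i, .inr l⟩) ∈ F :=
      Finset.mem_image.2 ⟨⟨i, l⟩, Finset.mem_univ _, rfl⟩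
    rw [Finset.insert_inter_of_mem hsF, Finset.card_insert_of_notMem (by
      simp only [Finset.mem_inter, not_and]; exact fun hh => absurd hh hnew'),
      Finset.erase_inter, Finset.erase_eq_of_notMem (by simp [heF])] at this
    lia

/-- In an adapted matching of the same size every star has at least two matched vertices, and the
stars are disjoint. If `M` misses the centre of star `i₀`, so does the adapted matching; then all
the leaves of that star are matched, and three of them force one more edge. -/
theorem IsStarPlacement.le_card_matching {t : ℕ} {m : Fin t → ℕ} {E M : Finset (Sym2 V)}
    {f : (Σ i : Fin t, Fin 1 ⊕ Fin (m i)) → V} (h : IsStarPlacement m E f)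
    (hm2 : ∀ i, 2 ≤ m i) (hME : M ⊆ E) (hM : ∀ v, edeg M v ≤ 1)
    (hmax : ∀ M' ⊆ E, (∀ v, edeg M' v ≤ 1) → M'.card ≤ M.card) (i₀ : Fin t) :
    t ≤ M.card ∧ (3 ≤ m i₀ → t + 1 ≤ M.card + edeg M (f ⟨i₀, .inl 0⟩)) := by
  obtain ⟨M', hc, hd, hst⟩ := h.exists_adapted_matching hME hM hmax i₀
  have hsum := h.sum_edeg_le M'
  have hleaves : ∀ i, (∀ j, 1 ≤ edeg M' (f ⟨i, .inr j⟩)) →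
      m i ≤ ∑ j, edeg M' (f ⟨i, .inr j⟩) := fun i hi => by
    simpa using Finset.card_nsmul_le_sum Finset.univ _ 1 fun j _ => hi j
  have hown : ∀ i j, s(f ⟨i, .inl 0⟩, f ⟨i, .inr j⟩) ∈ M' →
      1 ≤ edeg M' (f ⟨i, .inl 0⟩) ∧ 1 ≤ ∑ j, edeg M' (f ⟨i, .inr j⟩) := fun i j hij =>
    ⟨edeg_pos.2 ⟨_, hij, by simp⟩, le_trans (edeg_pos.2 ⟨_, hij, by simp⟩)
      (Finset.single_le_sum (f := fun j => edeg M' (f ⟨i, .inr j⟩)) (fun _ _ => Nat.zero_le _)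
        (Finset.mem_univ j))⟩
  have h2 : ∀ i, 2 ≤ edeg M' (f ⟨i, .inl 0⟩) + ∑ j, edeg M' (f ⟨i, .inr j⟩) := by
    intro i
    rcases hst i with ⟨j, hj⟩ | hi
    · have := hown i j hj
      lia
    · have := hleaves i hi
      have := hm2 i
      lia
  have ht : t ≤ M.card := by
    have := Finset.card_nsmul_le_sum Finset.univ _ 2 fun i _ => h2 i
    simp only [Finset.card_univ, Fintype.card_fin, smul_eq_mul] at this
    lia
  refine ⟨ht, fun h3 => ?_⟩
  by_cases hc0 : edeg M (f ⟨i₀, .inl 0⟩) = 0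
  · have h3' : 2 < edeg M' (f ⟨i₀, .inl 0⟩) + ∑ j, edeg M' (f ⟨i₀, .inr j⟩) := by
      rcases hst i₀ with ⟨j, hj⟩ | hi
      · have := (hown i₀ j hj).1
        lia
      · have := hleaves i₀ hi
        lia
    have := Finset.sum_lt_sum (fun i (_ : i ∈ Finset.univ) => h2 i) ⟨i₀, Finset.mem_univ _, h3'⟩
    simp only [Finset.sum_const, Finset.card_univ, Fintype.card_fin, smul_eq_mul] at this
    lia
  · lia

/-- Greedily peeling off `a` maximum matchings. -/
theorem exists_peeling (E : Finset (Sym2 V)) (a : ℕ) : ∃ R ⊆ E, (∀ v, edeg R v ≤ a) ∧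
    ∀ (t : ℕ) (m : Fin t → ℕ) (f : (Σ i : Fin t, Fin 1 ⊕ Fin (m i)) → V) (i₀ : Fin t),
      (∀ i, 2 ≤ m i) → IsStarPlacement m (E \ R) f →
      a * t ≤ R.card ∧ (3 ≤ m i₀ → a * (t + 1) ≤ R.card + edeg R (f ⟨i₀, .inl 0⟩)) := by
  induction a with
  | zero => exact ⟨∅, by simp, by simp, by simp⟩
  | succ a ih =>
    obtain ⟨R, hRE, hRa, hR⟩ := ih
    obtain ⟨M, hM, hmax⟩ := Finset.exists_max_image
      ((E \ R).powerset.filter fun M => ∀ v, edeg M v ≤ 1) Finset.card ⟨∅, by simp⟩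
    simp only [Finset.mem_filter, Finset.mem_powerset, and_imp] at hM hmax
    have hdisj : Disjoint R M := Finset.disjoint_of_subset_right hM.1 Finset.disjoint_sdiff
    refine ⟨R ∪ M, Finset.union_subset hRE (hM.1.trans Finset.sdiff_subset), fun v => ?_,
      fun t m f i₀ hm2 hf => ?_⟩
    · rw [edeg_union hdisj]
      exact Nat.add_le_add (hRa v) (hM.2 v)
    -- A forest avoiding all the peeled edges was already available when `M` was chosen.
    · have hf' : IsStarPlacement m (E \ R) f :=
        hf.mono (Finset.sdiff_subset_sdiff le_rfl Finset.subset_union_left)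
      have h1 := hR t m f i₀ hm2 hf'
      have h2 := hf'.le_card_matching hm2 hM.1 hM.2 hmax i₀
      rw [Finset.card_union_of_disjoint hdisj, edeg_union hdisj, add_mul, add_mul, one_mul, one_mul]
      refine ⟨Nat.add_le_add h1.1 h2.1, fun h3 => ?_⟩
      have h4 := h1.2 h3
      have h5 := h2.2 h3
      lia

end matching

/-! ### Red graphs without two disjoint stars -/

/-- Of two disjoint stars one avoids `v`, and its centre then has degree at least `a + 1` among the
edges off `v`. -/
theorem IsStarPlacement.not_of_edeg_le {V : Type*} [DecidableEq V] {R : Finset (Sym2 V)} {v : V}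
    {a : ℕ} (hR : ∀ u, u ≠ v → edeg (R.filter (v ∉ ·)) u ≤ a)
    (f : (Σ _ : Fin 2, Fin 1 ⊕ Fin (a + 1)) → V) :
    ¬ IsStarPlacement (fun _ => a + 1) R f := by
  intro h
  obtain ⟨i, hi⟩ : ∃ i, ∀ p, f ⟨i, p⟩ ≠ v := by
    by_contra! hcon
    obtain ⟨p, hp⟩ := hcon 0
    obtain ⟨q, hq⟩ := hcon 1
    simpa using congrArg Sigma.fst (h.inj (hp.trans hq.symm))
  have := hR _ (hi (.inl 0))
  have hcard := Finset.card_le_card_of_injOn (s := Finset.univ)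
    (t := (R.filter (v ∉ ·)).filter (f ⟨i, .inl 0⟩ ∈ ·))
    (fun j : Fin (a + 1) => s(f ⟨i, .inl 0⟩, f ⟨i, .inr j⟩))
    (fun j _ => by simpa [(hi _).symm] using h.mem i j)
    (fun j _ j' _ hj => by
      have := h.edge_inj (a₁ := ⟨i, j⟩) (a₂ := ⟨i, j'⟩) hj
      simpa using this)
  simp only [Finset.card_univ, Fintype.card_fin] at hcard
  unfold edeg at this
  lia

/-! ### Lower bound for the number of edges -/

section lower

variable {V : Type*} [DecidableEq V] [Fintype V]

/-- A set of edges of maximum degree at most `D` has a matching that misses at most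
`#E / (D + 1)` of the vertices of degree `D`. -/
theorem exists_matching_uncovered_le {E : Finset (Sym2 V)} (hE : ∀ e ∈ E, ¬ e.IsDiag) {D : ℕ}
    (hD : 0 < D) (hdeg : ∀ v, edeg E v ≤ D) :
    ∃ M ⊆ E, (∀ v, edeg M v ≤ 1) ∧
      (D + 1) * (Finset.univ.filter fun v => edeg E v = D ∧ edeg M v = 0).card ≤ E.card := by
  set U : Finset (Sym2 V) → Finset V := fun M =>
    Finset.univ.filter fun v => edeg E v = D ∧ edeg M v = 0 with hU
  obtain ⟨M, hM, hmin⟩ := Finset.exists_min_image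
    (E.powerset.filter fun M => ∀ v, edeg M v ≤ 1) (fun M => (U M).card) ⟨∅, by simp⟩
  simp only [Finset.mem_filter, Finset.mem_powerset, and_imp] at hM hmin
  obtain ⟨hME, hM1⟩ := hM
  refine ⟨M, hME, hM1, ?_⟩
  have hmemU : ∀ {v M}, v ∈ U M ↔ edeg E v = D ∧ edeg M v = 0 := by simp [hU]
  -- every neighbour of an uncovered vertex of degree `D` is matched
  have hcov : ∀ u ∈ U M, ∀ w, s(u, w) ∈ E → edeg M w = 1 := by
    intro u hu w huw
    by_contra hw
    have hw0 : edeg M w = 0 := by have := hM1 w; lia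
    have hu0 := (hmemU.1 hu).2
    have hnew : s(u, w) ∉ M := fun h => by
      have : 0 < edeg M u := edeg_pos.2 ⟨_, h, by simp⟩
      lia
    have := hmin (insert s(u, w) M) (Finset.insert_subset huw hME) (fun v => by
      rw [edeg_insert hnew]
      split_ifs with hv
      · rcases Sym2.mem_iff.1 hv with rfl | rfl <;> lia
      · exact hM1 v)
    refine absurd this (not_le.2 (Finset.card_lt_card ⟨fun v hv => ?_, fun h => ?_⟩))
    · rw [hmemU] at hv ⊢
      rw [edeg_insert hnew] at hv
      lia
    · have := (hmemU.1 (h hu)).2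
      rw [edeg_insert hnew] at this
      simp at this
  have hUcov : ∀ u ∈ U M, ∀ e ∈ M, u ∉ e := fun u hu e he hue => by
    have : 0 < edeg M u := edeg_pos.2 ⟨e, he, hue⟩
    have := (hmemU.1 hu).2
    lia
  -- no augmenting path of length three joins two uncovered vertices
  have haug : ∀ u ∈ U M, ∀ u' ∈ U M, ∀ w w', s(w, w') ∈ M → s(u, w) ∈ E → s(u', w') ∈ E →
      u = u' := by
    intro u hu u' hu' w w' hww huw huw'
    by_contra hne
    have hwU : w ≠ u ∧ w ≠ u' ∧ w' ≠ u ∧ w' ≠ u' :=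
      ⟨fun h => hUcov u hu _ hww (by simp [h]), fun h => hUcov u' hu' _ hww (by simp [h]),
        fun h => hUcov u hu _ hww (by simp [h]), fun h => hUcov u' hu' _ hww (by simp [h])⟩
    have hwne : w ≠ w' := fun h => hE _ (hME hww) (by simp [h])
    have h1 : s(u', w') ∉ M.erase s(w, w') := fun h =>
      hUcov u' hu' _ (Finset.mem_of_mem_erase h) (by simp)
    have h2 : s(u, w) ∉ insert s(u', w') (M.erase s(w, w')) := fun h => by
      rcases Finset.mem_insert.1 h with h | h
      · have : u ∈ s(u', w') := h ▸ Sym2.mem_mk_left u w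
        rcases Sym2.mem_iff.1 this with h | h
        · exact hne h
        · exact hwU.2.2.1 h.symm
      · exact hUcov u hu _ (Finset.mem_of_mem_erase h) (by simp)
    have hd : ∀ v, edeg (insert s(u, w) (insert s(u', w') (M.erase s(w, w')))) v =
        edeg M v + if v = u ∨ v = u' then 1 else 0 := by
      intro v
      rw [edeg_insert h2, edeg_insert h1, ← edeg_erase hww v]
      simp only [Sym2.mem_iff]
      grind
    have := hmin _ (Finset.insert_subset huw (Finset.insert_subset huw'
      ((Finset.erase_subset s(w, w') M).trans hME))) (fun v => by
        rw [hd]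
        split_ifs with hv
        · rcases hv with rfl | rfl
          · have := (hmemU.1 hu).2
            lia
          · have := (hmemU.1 hu').2
            lia
        · exact hM1 v)
    refine absurd this (not_le.2 (Finset.card_lt_card ⟨fun v hv => ?_, fun h => ?_⟩))
    · rw [hmemU] at hv ⊢
      rw [hd] at hv
      lia
    · have := (hmemU.1 (h hu)).2
      rw [hd] at this
      simp at this
  set EU := (U M).biUnion fun u => E.filter (u ∈ ·) with hEU
  have hmemEU : ∀ {e}, e ∈ EU ↔ ∃ u ∈ U M, e ∈ E ∧ u ∈ e := by simp [hEU]
  have hEUcard : EU.card = (U M).card * D := by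
    rw [hEU, Finset.card_biUnion]
    · exact Finset.sum_const_nat fun u hu => (hmemU.1 hu).1
    · intro u hu u' hu' hne
      refine Finset.disjoint_left.2 fun e he he' => ?_
      simp only [Finset.mem_filter] at he he'
      obtain rfl := (Sym2.mem_and_mem_iff hne).1 ⟨he.2, he'.2⟩
      have := hcov u hu u' he.1
      have := (hmemU.1 hu').2
      lia
  have hdisj : Disjoint EU M := by
    refine Finset.disjoint_left.2 fun e he heM => ?_
    obtain ⟨u, hu, -, hue⟩ := hmemEU.1 he
    exact hUcov u hu e heM hue
  have hEUM : EU.card + M.card ≤ E.card := by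
    rw [← Finset.card_union_of_disjoint hdisj]
    refine Finset.card_le_card (Finset.union_subset (fun e he => ?_) hME)
    obtain ⟨u, hu, he, -⟩ := hmemEU.1 he
    exact he
  -- Each edge of `EU` is charged to the matching edge at its matched end; no matching edge is
  -- charged more than `D` times.
  have hEUM' : EU.card ≤ M.card * D := by
    have hsub : EU ⊆ M.biUnion fun e => EU.filter fun e' => ∃ x ∈ e, x ∈ e' := by
      intro e' he'
      obtain ⟨u, hu, heE, w, rfl⟩ := hmemEU.1 he'
      have : 0 < edeg M w := by rw [hcov u hu w heE]; exact one_pos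
      obtain ⟨e, he, hwe⟩ := edeg_pos.1 this
      exact Finset.mem_biUnion.2 ⟨e, he, Finset.mem_filter.2 ⟨he', w, hwe, by simp⟩⟩
    refine (Finset.card_le_card hsub).trans (Finset.card_biUnion_le_card_mul _ _ _ fun e he => ?_)
    induction e with
    | h w w' =>
      -- the edges of `EU` at a matched vertex `x` have the form `s(u, x)`
      have hform : ∀ x, 0 < edeg M x → ∀ e ∈ EU, x ∈ e → ∃ u ∈ U M, e = s(u, x) ∧ e ∈ E := by
        intro x hx e' he' hxe
        obtain ⟨u, hu, heE, hue⟩ := hmemEU.1 he'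
        have hne : u ≠ x := by
          rintro rfl
          have := (hmemU.1 hu).2
          lia
        exact ⟨u, hu, (Sym2.mem_and_mem_iff hne).1 ⟨hue, hxe⟩, heE⟩
      have hw := hform w (edeg_pos.2 ⟨_, he, by simp⟩)
      have hw' := hform w' (edeg_pos.2 ⟨_, he, by simp⟩)
      by_cases h1 : ∃ e ∈ EU, w ∈ e
      · by_cases h2 : ∃ e ∈ EU, w' ∈ e
        · obtain ⟨e₁, he₁, hwe₁⟩ := h1
          obtain ⟨e₂, he₂, hwe₂⟩ := h2
          obtain ⟨u, hu, rfl, heu⟩ := hw e₁ he₁ hwe₁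
          obtain ⟨u', hu', rfl, heu'⟩ := hw' e₂ he₂ hwe₂
          obtain rfl := haug u hu u' hu' w w' he heu heu'
          -- With charges at both ends, `haug` leaves only the two edges from a single `u`; and `w`
          -- already has degree two.
          have hD2 : 2 ≤ D := by
            refine le_trans ?_ (hdeg w)
            have hne : s(u, w) ≠ s(w, w') := fun h => hUcov u hu _ he (h ▸ Sym2.mem_mk_left u w)
            rw [← Finset.card_pair hne]
            refine Finset.card_le_card fun e' he' => ?_
            rw [Finset.mem_insert, Finset.mem_singleton] at he'
            rcases he' with rfl | rfl
            · simp [heu]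
            · simp [hME he]
          refine le_trans (Finset.card_le_card (t := {s(u, w), s(u, w')}) fun e' he' => ?_)
            (Finset.card_le_two.trans hD2)
          obtain ⟨hmem, x, hx, hxe⟩ := Finset.mem_filter.1 he'
          rw [Finset.mem_insert, Finset.mem_singleton]
          rcases Sym2.mem_iff.1 hx with rfl | rfl
          · obtain ⟨u₁, hu₁, rfl, h₁⟩ := hw e' hmem hxe
            exact .inl (by rw [haug u₁ hu₁ u hu _ _ he h₁ heu'])
          · obtain ⟨u₁, hu₁, rfl, h₁⟩ := hw' e' hmem hxe
            exact .inr (by rw [haug u hu u₁ hu₁ _ _ he heu h₁])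
        · push Not at h2
          refine le_trans (Finset.card_le_card fun e' he' => ?_) (hdeg w)
          obtain ⟨hmem, x, hx, hxe⟩ := Finset.mem_filter.1 he'
          rcases Sym2.mem_iff.1 hx with rfl | rfl
          · obtain ⟨u₁, hu₁, -, h₁⟩ := hw e' hmem hxe
            exact Finset.mem_filter.2 ⟨h₁, hxe⟩
          · exact absurd hxe (h2 _ hmem)
      · push Not at h1
        refine le_trans (Finset.card_le_card fun e' he' => ?_) (hdeg w')
        obtain ⟨hmem, x, hx, hxe⟩ := Finset.mem_filter.1 he'
        rcases Sym2.mem_iff.1 hx with rfl | rfl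
        · exact absurd hxe (h1 _ hmem)
        · obtain ⟨u₁, hu₁, -, h₁⟩ := hw' e' hmem hxe
          exact Finset.mem_filter.2 ⟨h₁, hxe⟩
  have hUM : (U M).card ≤ M.card := Nat.le_of_mul_le_mul_right (hEUcard ▸ hEUM') hD
  calc (D + 1) * (U M).card = (U M).card * D + (U M).card := by ring
    _ ≤ EU.card + M.card := by rw [hEUcard]; lia
    _ ≤ E.card := hEUM

/-- `E → (2K_{1,a+1}, ⊔ K_{1,m i})` for a set of edges `E`. -/
def ArrowsStars {t : ℕ} (E : Finset (Sym2 V)) (a : ℕ) (m : Fin t → ℕ) : Prop :=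
  ∀ R ⊆ E, (∃ f, IsStarPlacement (fun _ : Fin 2 => a + 1) R f) ∨
    ∃ f, IsStarPlacement m (E \ R) f

/-- The edges at `v` and the `a` matchings peeled off the rest are red, so the blue remainder holds
the forest. -/
theorem ArrowsStars.le_card_of_maxDegree {t a : ℕ} {E : Finset (Sym2 V)} {m : Fin t → ℕ}
    (h : ArrowsStars E a m) (hm2 : ∀ i, 2 ≤ m i) (i₀ : Fin t) {v : V}
    (hv : ∀ u, edeg E u ≤ edeg E v) (hcase : 3 ≤ m i₀ ∨ a + m i₀ ≤ edeg E v) :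
    a + m i₀ + ∑ i, (a + m i) ≤ E.card := by
  set E' := E.filter (v ∉ ·) with hE'
  have hEE' : E' ⊆ E := Finset.filter_subset _ _
  obtain ⟨R, hRE, hRa, hR⟩ := exists_peeling E' a
  have hcard : edeg E v + E'.card = E.card := Finset.card_filter_add_card_filter_not _
  have hsd : E \ (E.filter (v ∈ ·) ∪ R) = E' \ R := by
    ext e
    simp only [hE', Finset.mem_sdiff, Finset.mem_union, Finset.mem_filter]
    tauto
  rcases h (E.filter (v ∈ ·) ∪ R) (Finset.union_subset (Finset.filter_subset _ _)
    (hRE.trans hEE')) with ⟨f, hf⟩ | ⟨f, hf⟩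
  · refine absurd hf (IsStarPlacement.not_of_edeg_le (v := v) (fun u _ => ?_) f)
    refine (edeg_mono (fun e he => ?_) u).trans (hRa u)
    simp only [Finset.mem_filter, Finset.mem_union] at he
    tauto
  · rw [hsd] at hf
    obtain ⟨h1, h2⟩ := hR t m f i₀ hm2 hf
    have h3 := hf.sum_le_card
    rw [Finset.card_sdiff_of_subset hRE] at h3
    have h4 := Finset.card_le_card hRE
    have h5 := hf.add_edeg_le hRE i₀
    have h6 := edeg_mono hEE' (f ⟨i₀, .inl 0⟩)
    have h7 := hv (f ⟨i₀, .inl 0⟩)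
    rw [Finset.sum_add_distrib]
    simp only [Finset.sum_const, Finset.card_univ, Fintype.card_fin, smul_eq_mul]
    -- For `m i₀ ≥ 3`, the degree of the centre of star `i₀` in `R` cancels between `h2` and `h5`,
    -- as `v` has at least that centre's degree.
    rcases hcase with h8 | h8
    · have := h2 h8
      lia
    · lia

/-- With too few edges, the matching misses at most `t` vertices of degree `a + 1`. One of them may
stay exceptional in red; making all edges at the others blue leaves fewer than `t` places for blue
stars. -/
theorem ArrowsStars.le_card_of_edeg_le {t a : ℕ} {E : Finset (Sym2 V)} {m : Fin t → ℕ}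
    (h : ArrowsStars E a m) (hE : ∀ e ∈ E, ¬ e.IsDiag) (ht : 0 < t) (hm2 : ∀ i, 2 ≤ m i)
    (hdeg : ∀ v, edeg E v ≤ a + 1) [Nonempty V] :
    (t + 1) * (a + 2) ≤ E.card := by
  obtain ⟨M, hME, hM1, hcard⟩ := exists_matching_uncovered_le hE a.succ_pos hdeg
  set U := Finset.univ.filter fun v => edeg E v = a + 1 ∧ edeg M v = 0 with hU
  by_contra! hlt
  have hUt : U.card < t + 1 := by
    have : (a + 2) * U.card < (a + 2) * (t + 1) := by
      rw [mul_comm (a + 2) (t + 1)]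
      exact lt_of_le_of_lt hcard hlt
    exact lt_of_mul_lt_mul_left' this
  obtain ⟨v, hv⟩ : ∃ v, (U.erase v).card < t := by
    rcases U.eq_empty_or_nonempty with h0 | ⟨v, hv⟩
    · exact ⟨Classical.arbitrary V, by simpa [h0] using ht⟩
    · refine ⟨v, ?_⟩
      rw [Finset.card_erase_of_mem hv]
      lia
  set B := M ∪ E.filter fun e => ∃ u ∈ U.erase v, u ∈ e with hB
  have hBE : B ⊆ E := Finset.union_subset hME (Finset.filter_subset _ _)
  rcases h (E \ B) Finset.sdiff_subset with ⟨f, hf⟩ | ⟨f, hf⟩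
  · refine absurd hf (IsStarPlacement.not_of_edeg_le (v := v) (fun u huv => ?_) f)
    refine (edeg_mono (Finset.filter_subset _ _) u).trans ?_
    have h1 := edeg_sdiff hBE u
    have h2 := edeg_mono (Finset.subset_union_left : M ⊆ B) u
    have h3 := hdeg u
    by_cases hu : u ∈ U
    · have : edeg (E \ B) u = 0 := by
        by_contra h0
        obtain ⟨e, he, hue⟩ := edeg_pos.1 (Nat.pos_of_ne_zero h0)
        rw [Finset.mem_sdiff] at he
        exact he.2 (Finset.mem_union_right _ (Finset.mem_filter.2
          ⟨he.1, u, Finset.mem_erase.2 ⟨huv, hu⟩, hue⟩))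
      lia
    · simp only [hU, Finset.mem_filter, Finset.mem_univ, true_and] at hu
      lia
  · rw [Finset.sdiff_sdiff_eq_self hBE] at hf
    -- A star avoiding `U.erase v` would put two edges of `M` at its centre.
    have hmeet : ∀ i, ∃ p, f ⟨i, p⟩ ∈ U.erase v := by
      intro i
      by_contra! hcon
      have hMi : ∀ j, s(f ⟨i, .inl 0⟩, f ⟨i, .inr j⟩) ∈ M := by
        intro j
        rcases Finset.mem_union.1 (hf.mem i j) with h | h
        · exact h
        · obtain ⟨-, u, hu, hue⟩ := Finset.mem_filter.1 h
          rcases Sym2.mem_iff.1 hue with rfl | rfl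
          · exact absurd hu (hcon _)
          · exact absurd hu (hcon _)
      have := edeg_le_one_iff.1 (hM1 (f ⟨i, .inl 0⟩)) _ (hMi ⟨0, by have := hm2 i; lia⟩) _
        (hMi ⟨1, by have := hm2 i; lia⟩) (by simp) (by simp)
      have := hf.edge_inj (a₁ := ⟨i, _⟩) (a₂ := ⟨i, _⟩) this
      simp at this
    choose p hp using hmeet
    have := Finset.card_le_card_of_injOn (s := Finset.univ) (t := U.erase v)
      (fun i => f ⟨i, p i⟩) (fun i _ => hp i)
      (fun i _ j _ hij => congrArg Sigma.fst (hf.inj hij))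
    simp only [Finset.card_univ, Fintype.card_fin] at this
    lia

theorem ArrowsStars.le_card {t a : ℕ} {E : Finset (Sym2 V)} {m : Fin t → ℕ}
    (h : ArrowsStars E a m) (hE : ∀ e ∈ E, ¬ e.IsDiag) (hm2 : ∀ i, 2 ≤ m i) {i₀ : Fin t}
    (hmax : ∀ i, m i ≤ m i₀) : a + m i₀ + ∑ i, (a + m i) ≤ E.card := by
  have : Nonempty V := by
    rcases h ∅ (Finset.empty_subset _) with ⟨f, hf⟩ | ⟨f, hf⟩
    · simpa using hf.mem 0 0
    · exact ⟨f ⟨i₀, .inl 0⟩⟩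
  obtain ⟨v, hv⟩ := Finite.exists_max (edeg E)
  by_cases hcase : 3 ≤ m i₀ ∨ a + m i₀ ≤ edeg E v
  · exact h.le_card_of_maxDegree hm2 i₀ hv hcase
  -- Now all `m i` are 2 and the maximum degree is below `a + 2`.
  · push Not at hcase
    have hm : ∀ i, m i = 2 := fun i => by
      have := hm2 i
      have := hmax i
      lia
    have := h.le_card_of_edeg_le hE i₀.pos hm2 fun u => (hv u).trans (by
      have := hm i₀
      lia)
    simp only [hm, Finset.sum_const, Finset.card_univ, Fintype.card_fin, smul_eq_mul]
    linarith

end lower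

theorem IsRamseyFor.arrowsStars {V : Type*} [DecidableEq V] [Fintype V] {G : SimpleGraph V}
    [Fintype G.edgeSet] {a t : ℕ} {m : Fin t → ℕ}
    (h : IsRamseyFor G (starForest fun _ : Fin 2 => a + 1) (starForest m)) :
    ArrowsStars G.edgeFinset a m := by
  intro R _
  refine (h fun e => if (e : Sym2 V) ∈ R then 0 else 1).imp ?_ ?_
  · rw [starForest_isContained_iff]
    rintro ⟨f, hf, hadj⟩
    refine ⟨f, hf, fun i j => ?_⟩
    obtain ⟨_, hR⟩ := (EdgeLabeling.labelGraph_adj _ _).1 (hadj i j)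
    simpa using hR
  · rw [starForest_isContained_iff]
    rintro ⟨f, hf, hadj⟩
    refine ⟨f, hf, fun i j => ?_⟩
    obtain ⟨hG, hR⟩ := (EdgeLabeling.labelGraph_adj _ _).1 (hadj i j)
    rw [Finset.mem_sdiff, mem_edgeFinset]
    exact ⟨hG, by simpa using hR⟩

theorem IsRamseyFor.le_ncard_edgeSet {V : Type*} [Finite V] {G : SimpleGraph V} {a t : ℕ}
    {m : Fin t → ℕ} (h : IsRamseyFor G (starForest fun _ : Fin 2 => a + 1) (starForest m))
    (hm2 : ∀ i, 2 ≤ m i) {i₀ : Fin t} (hmax : ∀ i, m i ≤ m i₀) :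
    a + m i₀ + ∑ i, (a + m i) ≤ G.edgeSet.ncard := by
  classical
  have := Fintype.ofFinite V
  rw [← coe_edgeFinset, Set.ncard_coe_finset]
  exact h.arrowsStars.le_card (fun e he => G.not_isDiag_of_mem_edgeSet (by simpa using he))
    hm2 hmax

/-! ### A star forest that arrows -/

theorem ncard_edgeSet_starForest {t : ℕ} (N : Fin t → ℕ) :
    (starForest N).edgeSet.ncard = ∑ i, N i := by
  have hrange : (starForest N).edgeSet = Set.range fun p : (Σ i : Fin t, Fin (N i)) =>
      s((⟨p.1, .inl 0⟩ : Σ i : Fin t, Fin 1 ⊕ Fin (N i)), ⟨p.1, .inr p.2⟩) := by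
    ext e
    induction e with
    | h a b =>
      rw [mem_edgeSet]
      constructor
      · rintro ⟨i, x, y, hxy, rfl, rfl⟩
        rcases x with x | x <;> rcases y with y | y
        · simp at hxy
        · exact ⟨⟨i, y⟩, by rw [Subsingleton.elim x 0]⟩
        · exact ⟨⟨i, x⟩, by rw [Subsingleton.elim y 0]; exact Sym2.eq_swap⟩
        · simp at hxy
      · rintro ⟨⟨i, j⟩, hij⟩
        rw [← mem_edgeSet, ← hij]
        exact ⟨i, .inl 0, .inr j, by simp, rfl, rfl⟩
  have hplace : IsStarPlacement N Finset.univ id :=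
    ⟨Function.injective_id, fun _ _ => Finset.mem_univ _⟩
  have hinj : Function.Injective fun p : (Σ i : Fin t, Fin (N i)) =>
      s((⟨p.1, .inl 0⟩ : Σ i : Fin t, Fin 1 ⊕ Fin (N i)), ⟨p.1, .inr p.2⟩) := hplace.edge_inj
  rw [hrange, ← Set.image_univ, Set.ncard_image_of_injective _ hinj, Set.ncard_univ]
  simp

/-- If in a subgraph `H` of a star forest the centres of the distinct stars `σ i` have at least
`m i` neighbours, then `H` contains `⊔ K_{1,m i}`. -/
theorem starForest_isContained_of_le_card {t k : ℕ} {m : Fin t → ℕ} {N : Fin k → ℕ}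
    {H : SimpleGraph (Σ i : Fin k, Fin 1 ⊕ Fin (N i))} {σ : Fin t → Fin k}
    (hσ : Function.Injective σ) (S : (i : Fin k) → Finset (Fin (N i)))
    (hS : ∀ i, ∀ j ∈ S i, H.Adj ⟨i, .inl 0⟩ ⟨i, .inr j⟩) (hm : ∀ i, m i ≤ (S (σ i)).card) :
    (starForest m).IsContained H := by
  rw [starForest_isContained_iff]
  have hg : ∀ i, ∃ g : Fin (m i) ↪ Fin (N (σ i)), ∀ j, g j ∈ S (σ i) := fun i => by
    obtain ⟨T, hT, hTc⟩ := Finset.exists_subset_card_eq (hm i)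
    exact ⟨(T.orderEmbOfFin hTc).toEmbedding, fun j => hT (T.orderEmbOfFin_mem hTc j)⟩
  choose g hg using hg
  refine ⟨fun p => ⟨σ p.1, Sum.map id (g p.1) p.2⟩, ?_, fun i j => hS _ _ (hg i j)⟩
  rintro ⟨i, x⟩ ⟨i', x'⟩ h
  obtain rfl : i = i' := hσ (congrArg Sigma.fst h)
  have h2 : Sum.map id (g i) x = Sum.map id (g i) x' := by simpa using h
  rw [Sum.map_injective.2 ⟨Function.injective_id, (g i).injective⟩ h2]

theorem isRamseyFor_starForest {a t : ℕ} {m : Fin t → ℕ} {i₀ : Fin t}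
    (hmax : ∀ i, m i ≤ m i₀) {N : Fin (t + 1) → ℕ} (h0 : N 0 = a + m i₀)
    (hs : ∀ i : Fin t, N i.succ = a + m i) :
    IsRamseyFor (starForest N) (starForest fun _ : Fin 2 => a + 1) (starForest m) := by
  classical
  intro C
  set S : Fin 2 → (i : Fin (t + 1)) → Finset (Fin (N i)) := fun c i =>
    Finset.univ.filter fun j => (C.labelGraph c).Adj ⟨i, .inl 0⟩ ⟨i, .inr j⟩ with hSdef
  have hS : ∀ c i, ∀ j ∈ S c i, (C.labelGraph c).Adj ⟨i, .inl 0⟩ ⟨i, .inr j⟩ := by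
    simp [hSdef]
  have hcover : ∀ i, N i ≤ (S 0 i).card + (S 1 i).card := fun i => by
    refine le_trans ?_ (Finset.card_union_le _ _)
    have : S 0 i ∪ S 1 i = Finset.univ := by
      refine Finset.eq_univ_of_forall fun j => ?_
      have hadj : (starForest N).Adj ⟨i, .inl 0⟩ ⟨i, .inr j⟩ :=
        ⟨i, .inl 0, .inr j, by simp, rfl, rfl⟩
      have hC : C ⟨s(_, _), hadj⟩ = 0 ∨ C ⟨s(_, _), hadj⟩ = 1 := by
        generalize C _ = c
        fin_cases c <;> simp
      simp only [hSdef, Finset.mem_union, Finset.mem_filter, Finset.mem_univ, true_and,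
        EdgeLabeling.labelGraph_adj]
      exact hC.imp (fun h => ⟨hadj, h⟩) fun h => ⟨hadj, h⟩
    rw [this, Finset.card_univ, Fintype.card_fin]
  by_cases hred : ∃ i j, i ≠ j ∧ a + 1 ≤ (S 0 i).card ∧ a + 1 ≤ (S 0 j).card
  · left
    obtain ⟨i, j, hij, hi, hj⟩ := hred
    refine starForest_isContained_of_le_card (σ := ![i, j]) ?_ (S 0) (hS 0) ?_
    · intro x y
      fin_cases x <;> fin_cases y <;> simp [hij, hij.symm]
    · intro x
      fin_cases x <;> simpa
  · right
    push Not at hred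
    have hblue : ∀ i, (S 0 i).card < a + 1 → N i - a ≤ (S 1 i).card := fun i hi => by
      have := hcover i
      lia
    by_cases hall : ∃ i : Fin t, a + 1 ≤ (S 0 i.succ).card
    · obtain ⟨k, hk⟩ := hall
      -- The spare star `0` stands in for the only star with more than `a` red edges; its size `a +
      -- m i₀` suffices for any `k`.
      refine starForest_isContained_of_le_card (σ := fun i => if i = k then 0 else i.succ)
        ?_ (S 1) (hS 1) fun i => ?_
      · intro x y hxy
        dsimp only at hxy
        split_ifs at hxy with hx hy hy
        · rw [hx, hy]
        · exact absurd hxy.symm (Fin.succ_ne_zero _)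
        · exact absurd hxy (Fin.succ_ne_zero _)
        · exact Fin.succ_injective _ hxy
      · by_cases hik : i = k
        · rw [if_pos hik]
          have := hblue 0 (hred _ _ (Fin.succ_ne_zero k) hk)
          have := hmax i
          lia
        · rw [if_neg hik]
          have := hblue i.succ (hred _ _ (fun h => hik (Fin.succ_injective _ h).symm) hk)
          have := hs i
          lia
    · push Not at hall
      refine starForest_isContained_of_le_card (Fin.succ_injective t) (S 1) (hS 1) fun i => ?_
      have := hblue i.succ (hall i)
      have := hs i
      lia

theorem theorem4 (n t : ℕ) (hn : 1 ≤ n) (ht : 0 < t) (m : Fin t → ℕ) (hm : Antitone m)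
    (hm2 : ∀ i, 2 ≤ m i) :
    sizeRamseyNumber (starForest fun _ : Fin 2 => n) (starForest m) =
      (n + m ⟨0, ht⟩ - 1) + ∑ i, (n + m i - 1) := by
  obtain ⟨a, rfl⟩ : ∃ a, n = a + 1 := ⟨n - 1, by lia⟩
  have hmax : ∀ i, m i ≤ m ⟨0, ht⟩ := fun i => hm (Fin.mk_le_mk.2 (Nat.zero_le _))
  have hsub : ∀ i, a + 1 + m i - 1 = a + m i := fun i => by lia
  simp only [hsub]
  have hmem : a + m ⟨0, ht⟩ + ∑ i, (a + m i) ∈ {e : ℕ | ∃ (V : Type) (_ : Finite V)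
      (G : SimpleGraph V), IsRamseyFor G (starForest fun _ : Fin 2 => a + 1) (starForest m) ∧
        G.edgeSet.ncard = e} :=
    ⟨_, inferInstance, _, isRamseyFor_starForest hmax
      (N := Fin.cons (a + m ⟨0, ht⟩) fun i => a + m i) rfl fun _ => rfl, by
      rw [ncard_edgeSet_starForest, Fin.sum_univ_succ]
      rfl⟩
  refine le_antisymm (Nat.sInf_le hmem) (le_csInf ⟨_, hmem⟩ ?_)
  rintro e ⟨V, _, G, hG, rfl⟩
  exact hG.le_ncard_edgeSet hm2 hmax
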